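/- Call a map between topological spaces perfect if it is continuous, closed and surjective and all its point preimages are compact. Call a collection $\mathcal C$ of compact metrizable spaces uniquely Polishable if there exist Polish (that is, separable and completely metrizable) spaces $X$, $Y$ and a perfect map $\pi\colon X\to Y$ such that for every $C\in\mathcal C$ there is exactly one $y\in Y$ for which the fiber $\pi^{-1}(y)$ is homeomorphic to $C$. A spiral over $[0,1]$ is a space homeomorphic to a metrizable compactification of $(0,1]$ whose remainder is homeomorphic to $[0,1]$. Let $\mathcal S([0,1])$ be the collection of all compact subsets of the Hilbert cube $[0,1]^{\mathbb N}$ that are spirals over $[0,1]$. **Corollary 2.6.** The collection $\mathcal S([0,1])$ is not uniquely Polishable. That is, there do not exist Polish spaces $X$, $Y$ and a perfect map $\pi\colon X\to Y$ such that every $S\in\mathcal S([0,1])$ is homeomorphic to $\pi^{-1}(y)$ for exactly one $y\in Y$. -/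

import Mathlib

open Topology TopologicalSpace

universe u v w

/-- The Hilbert cube `[0,1]^ℕ` with the product topology. -/
abbrev HilbertCube : Type := ℕ → unitInterval

/-- A perfect map: a continuous closed surjection with compact point preimages. -/
structure IsPerfectMap {X : Type*} {Y : Type*} [TopologicalSpace X] [TopologicalSpace Y]
    (π : X → Y) : Prop where
  continuous : Continuous π
  surjective : Function.Surjective π
  isClosedMap : IsClosedMap π
  isCompact_fiber : ∀ y : Y, IsCompact (π ⁻¹' {y})

/-- A collection `𝒞` of compact subsets of a space is uniquely Polishable if there are Polish
spaces `X`, `Y` and a perfect map `π : X → Y` such that every member of `𝒞` is homeomorphic to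
the fibre of `π` over exactly one point of `Y`. -/
def UniquelyPolishable {Q : Type w} [TopologicalSpace Q] (𝒞 : Set (Compacts Q)) : Prop :=
  ∃ (X : Type u) (Y : Type v) (_ : TopologicalSpace X) (_ : TopologicalSpace Y)
    (_ : PolishSpace X) (_ : PolishSpace Y) (π : X → Y),
    IsPerfectMap π ∧
      ∀ C ∈ 𝒞, ∃! y : Y, Nonempty ((π ⁻¹' {y} : Set X) ≃ₜ (C : Set Q))

/-- `S` is a spiral over `K`: `S` is a metrizable compactification of the half-open interval
`(0,1]` whose remainder is homeomorphic to `K`. This property is invariant under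
homeomorphisms of `S`. -/
structure IsSpiralOver (K : Type*) [TopologicalSpace K] (S : Type*) [TopologicalSpace S] :
    Prop where
  compactSpace : CompactSpace S
  metrizableSpace : MetrizableSpace S
  exists_ray : ∃ j : Set.Ioc (0 : ℝ) 1 → S,
    IsDenseEmbedding j ∧ Nonempty (((Set.range j)ᶜ : Set S) ≃ₜ K)

/-- The collection `𝒮(K)` of all spirals over `K` that are compact subsets of the Hilbert cube. -/
def spirals (K : Type*) [TopologicalSpace K] : Set (Compacts HilbertCube) :=
  {S | IsSpiralOver K (S : Set HilbertCube)}

open Set Filter Uniformity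
open scoped NNReal

/-! A point `x` of the Cantor space is encoded by a planar spiral: the graph of a row of tents with
heights in `{1/2, 1}`, squeezed towards a limit segment. Even tents have height 1, so the remainder
is the whole segment; odd heights spell out `x`. Changing finitely many bits of `x` does not change
the spiral up to homeomorphism (`nonempty_homeomorph_of_eventuallyEq`).

If the spirals were uniquely Polishable, sending `x` to the point whose fibre is its spiral would be
a Borel map (`measurable_of_unique_fiber`) invariant under finite changes. By the topological
zero-one law it would be constant on a comeagre, hence uncountable, set, so uncountably many of
these spirals would be homeomorphic.

This is impossible (`countable_of_homeomorph`). A homeomorphism from a fixed spiral reparametrizes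
the ray and, asymptotically, acts on heights by a function in the separable space `C(unitInterval,
ℝ)`. Uncountably many homeomorphisms would include uncountably many with nearly equal functions. The
corresponding rows of tents are then close after reparametrization, so their height sequences agree
up to a shift (`exists_shift_eq_of_tents_close`), which allows only countably many `x`. -/

/-! ### Coding fibres by dense sequences, and Borel selection -/

/-- Both spaces are Hausdorff completions of `ι` for the same uniformity, and completions are
unique. -/
theorem nonempty_homeomorph_of_comap_uniformity_eq {A B : Type*} [UniformSpace A] [UniformSpace B]
    [CompactSpace A] [CompactSpace B] [T0Space A] [T0Space B] {ι : Type*} {s : ι → A} {z : ι → B}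
    (hs : DenseRange s) (hz : DenseRange z)
    (h : comap (Prod.map s s) (𝓤 A) = comap (Prod.map z z) (𝓤 B)) : Nonempty (A ≃ₜ B) := by
  let : UniformSpace ι := UniformSpace.comap s inferInstance
  let pA : AbstractCompletion ι :=
    { space := A
      coe := s
      uniformStruct := inferInstance
      complete := inferInstance
      separation := inferInstance
      isUniformInducing := ⟨rfl⟩
      dense := hs }
  let pB : AbstractCompletion ι :=
    { space := B
      coe := z
      uniformStruct := inferInstance
      complete := inferInstance
      separation := inferInstance
      isUniformInducing := ⟨h.symm⟩
      dense := hz }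
  exact ⟨(pA.compareEquiv pB).toHomeomorph⟩

/-- Only countable quantifiers remain on the right, as Borel computations require. -/
theorem comap_uniformity_le_iff {A B ι : Type*} [PseudoMetricSpace A] [PseudoMetricSpace B]
    {s : ι → A} {z : ι → B} :
    comap (Prod.map s s) (𝓤 A) ≤ comap (Prod.map z z) (𝓤 B) ↔
      ∀ k : ℕ, ∃ l : ℕ, ∀ n m, dist (s n) (s m) < 1 / ((l : ℝ) + 1) →
        dist (z n) (z m) < 1 / ((k : ℝ) + 1) := by
  rw [(Metric.uniformity_basis_dist_inv_nat_succ.comap _).le_basis_iff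
    (Metric.uniformity_basis_dist_inv_nat_succ.comap _)]
  simp only [true_and, true_imp_iff]
  refine forall_congr' fun k => exists_congr fun l => ?_
  exact ⟨fun h n m hnm => @h (n, m) hnm, fun h p hp => h p.1 p.2 hp⟩

theorem IsPerfectMap.isProperMap {X Y : Type*} [TopologicalSpace X] [TopologicalSpace Y]
    {π : X → Y} (h : IsPerfectMap π) : IsProperMap π :=
  isProperMap_iff_isClosedMap_and_compact_fibers.2 ⟨h.continuous, h.isClosedMap, h.isCompact_fiber⟩

/-- The fibres of a proper map that are covered by the `ε`-balls around a given sequence form an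
open set. -/
theorem IsProperMap.isOpen_setOf_fiber_subset {X Y : Type*} [PseudoMetricSpace X]
    [TopologicalSpace Y] {π : X → Y} (h : IsProperMap π) (ε : ℝ) :
    IsOpen {q : Y × (ℕ → X) | ∀ p, π p = q.1 → ∃ n, dist p (q.2 n) < ε} := by
  -- The uncovered pairs are the image of a closed set under `π × id`, which is closed because `π`
  -- is proper.
  have h1 : IsClosedMap (Prod.map π (id : (ℕ → X) → (ℕ → X))) :=
    (h.prodMap isProperMap_id).isClosedMap
  have h2 : IsClosed {q : X × (ℕ → X) | ∀ n, ε ≤ dist q.1 (q.2 n)} := by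
    simp only [ofPred_forall]
    exact isClosed_iInter fun n => isClosed_le continuous_const (by fun_prop)
  rw [← isClosed_compl_iff]
  convert h1 _ h2 using 1
  ext ⟨y, z⟩
  simp only [mem_compl_iff, mem_ofPred_eq, not_forall, not_exists, not_lt, mem_image, Prod.map,
    Prod.exists, Prod.mk.injEq, id]
  constructor
  · rintro ⟨p, hp, hd⟩
    exact ⟨p, z, hd, hp, rfl⟩
  · rintro ⟨p, z', hd, hp, rfl⟩
    exact ⟨p, hp, hd⟩

/-- `z` is a dense sequence in the fibre of `π` over `y`, and it carries the same uniformity as the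
sequence `s`. -/
def CodesFiber {X Y M : Type*} [PseudoMetricSpace X] [PseudoMetricSpace M] (π : X → Y)
    (s : ℕ → M) (y : Y) (z : ℕ → X) : Prop :=
  (∀ n, π (z n) = y) ∧ (∀ k : ℕ, ∀ p, π p = y → ∃ n, dist p (z n) < 1 / ((k : ℝ) + 1)) ∧
  (∀ k : ℕ, ∃ l : ℕ, ∀ n m, dist (s n) (s m) < 1 / ((l : ℝ) + 1) →
    dist (z n) (z m) < 1 / ((k : ℝ) + 1)) ∧
  (∀ k : ℕ, ∃ l : ℕ, ∀ n m, dist (z n) (z m) < 1 / ((l : ℝ) + 1) →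
    dist (s n) (s m) < 1 / ((k : ℝ) + 1))

/-- A homeomorphism of compact spaces is uniform, so it carries `s` to a code; conversely a code
presents the fibre and `T` as completions of the same uniform structure on `ℕ`. -/
theorem exists_codesFiber_iff {X Y M : Type*} [MetricSpace X] [MetricSpace M] [TopologicalSpace Y]
    {π : X → Y} (h : IsPerfectMap π) {T : Set M} (hT : IsCompact T) {s : ℕ → T}
    (hs : DenseRange s) (y : Y) :
    (∃ z, CodesFiber π (fun n => (s n : M)) y z) ↔ Nonempty ((π ⁻¹' {y} : Set X) ≃ₜ T) := by
  have : CompactSpace T := isCompact_iff_compactSpace.1 hT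
  have : CompactSpace (π ⁻¹' {y} : Set X) := isCompact_iff_compactSpace.1 (h.isCompact_fiber y)
  constructor
  · rintro ⟨z, h1, h2, h3, h4⟩
    let z' : ℕ → (π ⁻¹' {y} : Set X) := fun n => ⟨z n, h1 n⟩
    have hz' : DenseRange z' := by
      rw [Metric.denseRange_iff]
      intro p r hr
      obtain ⟨k, hk⟩ := exists_nat_one_div_lt hr
      obtain ⟨n, hn⟩ := h2 k p p.2
      exact ⟨n, hn.trans hk⟩
    exact nonempty_homeomorph_of_comap_uniformity_eq hz' hs
      (le_antisymm (comap_uniformity_le_iff.2 h4) (comap_uniformity_le_iff.2 h3))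
  · rintro ⟨e⟩
    have hz : DenseRange (e.symm ∘ s) := e.symm.surjective.denseRange.comp hs e.symm.continuous
    let e' : T ≃ᵤ (π ⁻¹' {y} : Set X) :=
      { e.symm with
        uniformContinuous_toFun := CompactSpace.uniformContinuous_of_continuous e.symm.continuous
        uniformContinuous_invFun := CompactSpace.uniformContinuous_of_continuous e.continuous }
    have key : comap (Prod.map s s) (𝓤 T) =
        comap (Prod.map (fun n => e.symm (s n)) (fun n => e.symm (s n)))
          (𝓤 (π ⁻¹' {y} : Set X)) := by
      rw [← e'.isUniformInducing.comap_uniformity, comap_comap]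
      rfl
    refine ⟨fun n => (e.symm (s n) : X), fun n => (e.symm (s n)).2, fun k p hp => ?_,
      fun k => comap_uniformity_le_iff.1 key.le k, fun k => comap_uniformity_le_iff.1 key.ge k⟩
    exact Metric.denseRange_iff.1 hz ⟨p, hp⟩ _ Nat.one_div_pos_of_nat

/-- Density in the fibre is the only clause with an uncountable quantifier; properness of `π` makes
it open for each `k`. -/
theorem measurableSet_setOf_codesFiber {P X Y M : Type*} [TopologicalSpace P]
    [SecondCountableTopology P] [MeasurableSpace P] [BorelSpace P]
    [MetricSpace X] [SecondCountableTopology X] [MeasurableSpace X] [BorelSpace X]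
    [TopologicalSpace Y] [T2Space Y] [SecondCountableTopology Y] [MeasurableSpace Y] [BorelSpace Y]
    [MetricSpace M] {π : X → Y} (h : IsPerfectMap π) {s : P → ℕ → M}
    (hs : ∀ n, Continuous fun x => s x n) :
    MeasurableSet {q : P × Y × (ℕ → X) | CodesFiber π (s q.1) q.2.1 q.2.2} := by
  have hπ := h.continuous
  unfold CodesFiber
  simp only [ofPred_and, ofPred_forall, ofPred_exists]
  have hA : ∀ n m (c : ℝ), MeasurableSet {q : P × Y × (ℕ → X) | dist (s q.1 n) (s q.1 m) < c} :=
    fun n m c => (isOpen_lt (by fun_prop) continuous_const).measurableSet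
  have hB : ∀ n m (c : ℝ), MeasurableSet {q : P × Y × (ℕ → X) | dist (q.2.2 n) (q.2.2 m) < c} :=
    fun n m c => (isOpen_lt (by fun_prop) continuous_const).measurableSet
  refine .inter (.iInter fun n => ?_) (.inter (.iInter fun k => ?_) (.inter ?_ ?_))
  · exact (isClosed_eq (by fun_prop) (by fun_prop)).measurableSet
  · have := (h.isProperMap.isOpen_setOf_fiber_subset (1 / ((k : ℝ) + 1))).preimage
      (continuous_snd (X := P))
    convert this.measurableSet using 1
    ext; simp
  · refine .iInter fun k => .iUnion fun l => .iInter fun n => .iInter fun m => ?_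
    simp only [imp_iff_not_or]
    exact (hA n m _).compl.union (hB n m _)
  · refine .iInter fun k => .iUnion fun l => .iInter fun n => .iInter fun m => ?_
    simp only [imp_iff_not_or]
    exact (hB n m _).compl.union (hA n m _)

/-- If `f` selects the unique fibre of a perfect map homeomorphic to the compact set `T x`, where
`T x` has a dense sequence that varies continuously with `x`, then `f` is Borel. -/
theorem measurable_of_unique_fiber {P X Y M : Type*} [TopologicalSpace P] [PolishSpace P]
    [MeasurableSpace P] [BorelSpace P] [TopologicalSpace X] [PolishSpace X]
    [TopologicalSpace Y] [PolishSpace Y] [MeasurableSpace Y] [BorelSpace Y]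
    [MetricSpace M] {π : X → Y} (h : IsPerfectMap π) {T : P → Set M} (hT : ∀ x, IsCompact (T x))
    {s : ∀ x, ℕ → T x} (hd : ∀ x, DenseRange (s x)) (hs : ∀ n, Continuous fun x => (s x n : M))
    {f : P → Y} (hf : ∀ x y, Nonempty ((π ⁻¹' {y} : Set X) ≃ₜ T x) ↔ y = f x) :
    Measurable f := by
  let := upgradeIsCompletelyMetrizable X
  let : MeasurableSpace X := borel X
  have : BorelSpace X := ⟨rfl⟩
  -- Preimages are projections of Borel sets. Applied to `V` and to its complement, this gives Borel
  -- preimages by Suslin's theorem.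
  have key : ∀ V : Set Y, MeasurableSet V → MeasureTheory.AnalyticSet (f ⁻¹' V) := by
    intro V hV
    have hm : MeasurableSet ({q : P × Y × (ℕ → X) |
        CodesFiber π (fun n => (s q.1 n : M)) q.2.1 q.2.2} ∩ {q | q.2.1 ∈ V}) :=
      (measurableSet_setOf_codesFiber h hs).inter (measurable_snd.fst hV)
    convert hm.analyticSet_image measurable_fst using 1
    ext x
    simp only [mem_preimage, mem_image, mem_inter_iff, mem_ofPred_eq]
    constructor
    · intro hx
      obtain ⟨z, hz⟩ := (exists_codesFiber_iff h (hT x) (hd x) (f x)).2 ((hf x (f x)).2 rfl)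
      exact ⟨(x, f x, z), ⟨hz, hx⟩, rfl⟩
    · rintro ⟨⟨x, y, z⟩, ⟨hz, hy⟩, rfl⟩
      change f x ∈ V
      rwa [← (hf x y).1 ((exists_codesFiber_iff h (hT x) (hd x) y).1 ⟨z, hz⟩)]
  exact fun V hV => (key V hV).measurableSet_of_compl (key Vᶜ hV.compl)

/-! ### Category and eventual equality on the Cantor space -/

/-- The self-homeomorphism of the Cantor space that changes the coordinates in `F`. -/
def flipHomeomorph (F : Finset ℕ) : (ℕ → Bool) ≃ₜ (ℕ → Bool) where
  toFun x n := xor (x n) (decide (n ∈ F))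
  invFun x n := xor (x n) (decide (n ∈ F))
  left_inv x := by ext n; simp
  right_inv x := by ext n; simp
  continuous_toFun := continuous_pi fun n =>
    (continuous_of_discreteTopology (f := fun b : Bool => xor b (decide (n ∈ F)))).comp
      (continuous_apply n)
  continuous_invFun := continuous_pi fun n =>
    (continuous_of_discreteTopology (f := fun b : Bool => xor b (decide (n ∈ F)))).comp
      (continuous_apply n)

theorem flipHomeomorph_apply (F : Finset ℕ) (x : ℕ → Bool) (n : ℕ) :
    flipHomeomorph F x n = xor (x n) (decide (n ∈ F)) := rfl

theorem flipHomeomorph_eventuallyEq (F : Finset ℕ) (x : ℕ → Bool) :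
    flipHomeomorph F x =ᶠ[atTop] x := by
  obtain ⟨N, hN⟩ := F.bddAbove
  filter_upwards [eventually_gt_atTop N] with n hn
  have : n ∉ F := fun h => (hN h).not_gt hn
  simp [flipHomeomorph_apply, this]

theorem exists_flipHomeomorph_eq {x y : ℕ → Bool} (h : x =ᶠ[atTop] y) :
    ∃ F, flipHomeomorph F y = x := by
  obtain ⟨N, hN⟩ := eventually_atTop.1 h
  refine ⟨(Finset.range N).filter fun n => x n ≠ y n, funext fun n => ?_⟩
  by_cases hn : n < N
  · cases hx : x n <;> cases hy : y n <;> simp [flipHomeomorph_apply, hn, hx, hy]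
  · simp [flipHomeomorph_apply, hn, hN n (not_lt.1 hn)]

theorem countable_setOf_eventuallyEq (y : ℕ → Bool) :
    {x : ℕ → Bool | x =ᶠ[atTop] y}.Countable :=
  (countable_range fun F => flipHomeomorph F y).mono fun _ hx => exists_flipHomeomorph_eq hx

theorem exists_flipHomeomorph_mem {U : Set (ℕ → Bool)} (hU : IsOpen U) (hne : U.Nonempty)
    (x : ℕ → Bool) : ∃ F, flipHomeomorph F x ∈ U := by
  obtain ⟨z, hz⟩ := hne
  obtain ⟨I, u, hu, hI⟩ := isOpen_pi_iff.1 hU z hz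
  refine ⟨I.filter fun n => x n ≠ z n, hI fun n hn => ?_⟩
  have : flipHomeomorph (I.filter fun n => x n ≠ z n) x n = z n := by
    have hn' : n ∈ I := hn
    cases hx : x n <;> cases hy : z n <;> simp [flipHomeomorph_apply, hn', hx, hy]
  rw [this]
  exact (hu n hn).2

/-- Topological zero-one law for tail sets in the Cantor space. -/
theorem isMeagre_or_mem_residual_of_flip_invariant {E : Set (ℕ → Bool)} (hE : BaireMeasurableSet E)
    (hinv : ∀ F x, x ∈ E → flipHomeomorph F x ∈ E) : IsMeagre E ∨ E ∈ residual (ℕ → Bool) := by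
  obtain ⟨U, hU, hEU⟩ := hE.residualEq_isOpen
  have hA : {x | x ∈ E ↔ x ∈ U} ∈ residual (ℕ → Bool) := hEU.mono fun _ h => iff_of_eq h
  rcases U.eq_empty_or_nonempty with rfl | hne
  · left
    exact mem_of_superset hA fun x hx => by simpa using hx
  · right
    -- There are countably many flips, so generically `E` and `U` agree on the whole orbit of `x`,
    -- and this orbit is dense and meets `U`.
    have hB : ∀ F, flipHomeomorph F ⁻¹' {x | x ∈ E ↔ x ∈ U} ∈ residual (ℕ → Bool) := fun F =>
      tendsto_residual_of_isOpenMap (flipHomeomorph F).continuous (flipHomeomorph F).isOpenMap hA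
    refine mem_of_superset (countable_iInter_mem.2 hB) fun x hx => ?_
    obtain ⟨F, hF⟩ := exists_flipHomeomorph_mem hU hne x
    have h1 : flipHomeomorph F x ∈ E := (mem_iInter.1 hx F).2 hF
    have h2 := hinv F _ h1
    rwa [show flipHomeomorph F (flipHomeomorph F x) = x from (flipHomeomorph F).left_inv x] at h2

/-- A Borel function on the Cantor space that depends on the tail only is generically constant. -/
theorem exists_mem_residual_eq_of_flip_invariant {Y : Type*} [TopologicalSpace Y] [T0Space Y]
    [SecondCountableTopology Y] [MeasurableSpace Y] [OpensMeasurableSpace Y] {f : (ℕ → Bool) → Y}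
    (hf : Measurable f) (hinv : ∀ F x, f (flipHomeomorph F x) = f x) :
    ∃ A ∈ residual (ℕ → Bool), ∀ x ∈ A, ∀ y ∈ A, f x = f y := by
  -- The preimage of a basic open set is meagre or comeagre, so membership of `f x` in it is
  -- generically constant; a countable basis separates the points of `Y`.
  have hb : ∀ U ∈ countableBasis Y,
      {x | ∀ᶠ y in residual (ℕ → Bool), f x ∈ U ↔ f y ∈ U} ∈ residual (ℕ → Bool) := by
    intro U hU
    have hm : BaireMeasurableSet (f ⁻¹' U) :=
      (hf (isOpen_of_mem_countableBasis hU).measurableSet).baireMeasurableSet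
    rcases isMeagre_or_mem_residual_of_flip_invariant hm
      (fun F x hx => by rwa [mem_preimage, hinv]) with h | h
    · filter_upwards [h] with x hx
      filter_upwards [h] with y hy
      exact ⟨fun h => (hx h).elim, fun h => (hy h).elim⟩
    · filter_upwards [h] with x hx
      filter_upwards [h] with y hy
      exact ⟨fun _ => hy, fun _ => hx⟩
  have hA := (countable_bInter_mem (countable_countableBasis Y)).2 hb
  refine ⟨_, hA, fun x hx y hy => ?_⟩
  refine ((isBasis_countableBasis Y).inseparable_iff.2 fun U hU => ?_).eq
  have h1 : ∀ᶠ z in residual (ℕ → Bool), f x ∈ U ↔ f z ∈ U := mem_iInter₂.1 hx U hU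
  have h2 : ∀ᶠ z in residual (ℕ → Bool), f y ∈ U ↔ f z ∈ U := mem_iInter₂.1 hy U hU
  obtain ⟨z, hz1, hz2⟩ := (dense_of_mem_residual (h1.and h2)).nonempty
  exact hz1.trans hz2.symm

theorem not_countable_of_mem_residual {A : Set (ℕ → Bool)} (hA : A ∈ residual (ℕ → Bool)) :
    ¬ A.Countable := by
  intro hc
  have h1 : ∀ x : ℕ → Bool, ({x}ᶜ : Set (ℕ → Bool)) ∈ residual (ℕ → Bool) := by
    intro x
    refine residual_of_dense_open isClosed_singleton.isOpen_compl ?_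
    rw [← interior_eq_empty_iff_dense_compl, ← not_nonempty_iff_eq_empty]
    intro hne
    have h2 : ∀ z, ∃ F, flipHomeomorph F z = x := fun z =>
      (exists_flipHomeomorph_mem isOpen_interior hne z).imp fun F hF =>
        mem_singleton_iff.1 (interior_subset hF)
    -- If `x` were isolated, every point would flip to `x`; the pointwise negation of `x` differs
    -- from it everywhere.
    obtain ⟨F, hF⟩ := h2 fun n => !(x n)
    have h3 := flipHomeomorph_eventuallyEq F fun n => !(x n)
    rw [hF] at h3
    obtain ⟨n, hn⟩ := h3.exists
    simp at hn
  have h4 := (countable_bInter_mem hc).2 fun x _ => h1 x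
  obtain ⟨x, hx, hx'⟩ := (dense_of_mem_residual (inter_mem hA h4)).nonempty
  exact mem_iInter₂.1 hx' x hx rfl

/-- An uncountable family of points of a second countable metric space has an uncountable
subfamily of small diameter. -/
theorem exists_not_countable_dist_lt {α β : Type*} [PseudoMetricSpace β] [SeparableSpace β]
    {A : Set α} (hA : ¬ A.Countable) (h : α → β) {ε : ℝ} (hε : 0 < ε) :
    ∃ B ⊆ A, ¬ B.Countable ∧ ∀ x ∈ B, ∀ y ∈ B, dist (h x) (h y) < ε := by
  obtain ⟨D, hDc, hDd⟩ := exists_countable_dense β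
  by_contra! hcon
  have hsub : A ⊆ ⋃ d ∈ D, {x ∈ A | dist (h x) d < ε / 2} := by
    intro x hx
    obtain ⟨d, hd, hxd⟩ := Metric.dense_iff.1 hDd (h x) (ε / 2) (by positivity)
    exact mem_iUnion₂.2 ⟨d, hxd, hx, by rwa [dist_comm]⟩
  refine hA ((hDc.biUnion fun d _ => ?_).mono hsub)
  by_contra hB
  obtain ⟨x, hx, y, hy, hxy⟩ := hcon _ (sep_subset _ _) hB
  have := dist_triangle_right (h x) (h y) d
  linarith [hx.2, hy.2]

/-! ### Rows of tents and their rigidity -/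

/-- The function on the half-line whose graph over `[n, n + 1]` is a tent of height `a n`. -/
noncomputable def tents (a : ℕ → ℝ) (t : ℝ≥0) : ℝ :=
  a ⌊t⌋₊ * (1 - |2 * ((t : ℝ) - (⌊t⌋₊ : ℝ)) - 1|)

section Tents

variable {a b : ℕ → ℝ}

/-- At the right endpoint the floor has already jumped to `n + 1`, but both neighbouring tents
vanish there. -/
theorem tents_eq_of_mem_Icc (a : ℕ → ℝ) {t : ℝ≥0} {n : ℕ} (h1 : (n : ℝ) ≤ t) (h2 : (t : ℝ) ≤ n + 1) :
    tents a t = a n * (1 - |2 * ((t : ℝ) - n) - 1|) := by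
  rcases h2.lt_or_eq with h2 | h2
  · have : ⌊t⌋₊ = n := (Nat.floor_eq_iff t.2).2 ⟨by exact_mod_cast h1, by exact_mod_cast h2⟩
    rw [tents, this]
  · have ht : t = ((n + 1 : ℕ) : ℝ≥0) := by
      apply NNReal.coe_injective
      push_cast
      exact h2
    rw [tents, ht, Nat.floor_natCast]
    push_cast
    norm_num

theorem natFloor_le_coe (t : ℝ≥0) : (⌊t⌋₊ : ℝ) ≤ t := by exact_mod_cast Nat.floor_le t.2

theorem coe_le_natFloor_add_one (t : ℝ≥0) : (t : ℝ) ≤ ⌊t⌋₊ + 1 := by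
  exact_mod_cast (Nat.lt_floor_add_one t).le

theorem tent_nonneg {x : ℝ} (h0 : 0 ≤ x) (h1 : x ≤ 1) : 0 ≤ 1 - |2 * x - 1| := by
  have : |2 * x - 1| ≤ 1 := abs_le.2 ⟨by linarith, by linarith⟩
  linarith

theorem tents_nonneg (ha : ∀ n, 0 ≤ a n) (t : ℝ≥0) : 0 ≤ tents a t :=
  mul_nonneg (ha _) (tent_nonneg (by linarith [natFloor_le_coe t])
    (by linarith [coe_le_natFloor_add_one t]))

theorem tents_le (a : ℕ → ℝ) (ha : ∀ n, 0 ≤ a n) {t : ℝ≥0} {n : ℕ} (h1 : (n : ℝ) ≤ t)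
    (h2 : (t : ℝ) ≤ n + 1) : tents a t ≤ a n := by
  rw [tents_eq_of_mem_Icc a h1 h2]
  exact mul_le_of_le_one_right (ha n) (by linarith [abs_nonneg (2 * ((t : ℝ) - n) - 1)])

theorem tents_le_one (ha : ∀ n, 0 ≤ a n) (ha' : ∀ n, a n ≤ 1) (t : ℝ≥0) : tents a t ≤ 1 :=
  (tents_le a ha (natFloor_le_coe t) (coe_le_natFloor_add_one t)).trans (ha' _)

theorem tents_zero (a : ℕ → ℝ) : tents a 0 = 0 := by simp [tents]

theorem tents_add_half (a : ℕ → ℝ) (n : ℕ) : tents a (n + 1 / 2) = a n := by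
  rw [tents_eq_of_mem_Icc a (n := n)] <;> push_cast <;> norm_num

theorem tents_natCast (a : ℕ → ℝ) (n : ℕ) : tents a n = 0 := by simp [tents]

theorem continuous_tents (a : ℕ → ℝ) : Continuous (tents a) := by
  rw [continuous_iff_continuousAt]
  intro t
  obtain ⟨N, hN⟩ := exists_nat_gt t
  -- Locally the function is a finite sum of tents truncated at zero, of which only the one indexed
  -- by the floor survives.
  have hc : Continuous fun s : ℝ≥0 => ∑ n ∈ Finset.range N, a n * max 0 (1 - |2 * ((s : ℝ) - n) - 1|) := by
    fun_prop
  refine hc.continuousAt.congr ?_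
  filter_upwards [eventually_lt_nhds hN] with s hs
  rw [Finset.sum_eq_single ⌊s⌋₊]
  · rw [tents, max_eq_right]
    exact tent_nonneg (by linarith [natFloor_le_coe s]) (by linarith [coe_le_natFloor_add_one s])
  · intro n _ hn
    rw [max_eq_left, mul_zero]
    rcases hn.lt_or_gt with hn | hn
    · have h1 : (n : ℝ) + 1 ≤ ⌊s⌋₊ := by exact_mod_cast hn
      have h2 := natFloor_le_coe s
      rw [abs_of_nonneg] <;> linarith
    · have h1 : (⌊s⌋₊ : ℝ) + 1 ≤ n := by exact_mod_cast hn
      have h2 := coe_le_natFloor_add_one s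
      rw [abs_of_nonpos] <;> linarith
  · intro h
    exact (h (Finset.mem_range.2 ((Nat.floor_lt s.2).2 hs))).elim

/-- Heights of at least `1/2` force slopes of at least 1, so the function dominates the distance to
`ℕ`. -/
theorem exists_abs_sub_natCast_lt (ha : ∀ n, 1 / 2 ≤ a n) {t : ℝ≥0} {ε : ℝ} (h : tents a t < ε) :
    ∃ n : ℕ, |(t : ℝ) - n| < ε := by
  have h1 := natFloor_le_coe t
  have h2 := coe_le_natFloor_add_one t
  have h3 : 1 / 2 * (1 - |2 * ((t : ℝ) - (⌊t⌋₊ : ℝ)) - 1|) < ε :=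
    (mul_le_mul_of_nonneg_right (ha ⌊t⌋₊) (tent_nonneg (by linarith) (by linarith))).trans_lt h
  rcases le_total (2 * ((t : ℝ) - (⌊t⌋₊ : ℝ)) - 1) 0 with h4 | h4
  · rw [abs_of_nonpos h4] at h3
    exact ⟨⌊t⌋₊, by rw [abs_of_nonneg] <;> linarith⟩
  · rw [abs_of_nonneg h4] at h3
    refine ⟨⌊t⌋₊ + 1, ?_⟩
    push_cast
    rw [abs_of_nonpos] <;> linarith

theorem tents_le_two_mul_abs_sub (ha' : ∀ n, a n ≤ 1) (t : ℝ≥0) (m : ℕ) :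
    tents a t ≤ 2 * |(t : ℝ) - m| := by
  have h1 := natFloor_le_coe t
  have h2 := coe_le_natFloor_add_one t
  have h3 : tents a t ≤ 1 - |2 * ((t : ℝ) - (⌊t⌋₊ : ℝ)) - 1| :=
    mul_le_of_le_one_left (tent_nonneg (by linarith) (by linarith)) (ha' _)
  rcases le_or_gt m ⌊t⌋₊ with h | h
  · have h4 : (m : ℝ) ≤ ⌊t⌋₊ := by exact_mod_cast h
    linarith [neg_le_abs (2 * ((t : ℝ) - (⌊t⌋₊ : ℝ)) - 1), le_abs_self ((t : ℝ) - m)]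
  · have h4 : (⌊t⌋₊ : ℝ) + 1 ≤ m := by exact_mod_cast h
    linarith [le_abs_self (2 * ((t : ℝ) - (⌊t⌋₊ : ℝ)) - 1), neg_le_abs ((t : ℝ) - m)]

/-- The zeros of two sequences of tents that are close after reparametrization correspond, and so do
the heights of the tents. -/
theorem exists_shift_eq_of_tents_close (ha : ∀ n, a n = 1 / 2 ∨ a n = 1)
    (hb : ∀ n, b n = 1 / 2 ∨ b n = 1) (τ : ℝ≥0 ≃o ℝ≥0)
    (h : ∀ᶠ t in atTop, |tents b (τ t) - tents a t| < 1 / 8) :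
    ∃ N M, ∀ k, a (N + k) = b (M + k) := by
  have half_le : ∀ {c : ℕ → ℝ}, (∀ n, c n = 1 / 2 ∨ c n = 1) → ∀ n, 1 / 2 ≤ c n := fun hc n => by
    rcases hc n with h | h <;> rw [h] <;> norm_num
  have le_one : ∀ {c : ℕ → ℝ}, (∀ n, c n = 1 / 2 ∨ c n = 1) → ∀ n, c n ≤ 1 := fun hc n => by
    rcases hc n with h | h <;> rw [h] <;> norm_num
  have nonneg : ∀ {c : ℕ → ℝ}, (∀ n, c n = 1 / 2 ∨ c n = 1) → ∀ n, 0 ≤ c n := fun hc n =>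
    le_trans (by norm_num) (half_le hc n)
  have near : ∀ {c : ℕ → ℝ}, (∀ n, c n = 1 / 2 ∨ c n = 1) → ∀ (t : ℝ≥0) (m : ℕ),
      (m : ℝ) - 1 / 8 < t → (t : ℝ) < m + 1 / 8 → tents c t < 1 / 4 := by
    intro c hc t m h1 h2
    have h3 := tents_le_two_mul_abs_sub (le_one hc) t m
    have h4 : |(t : ℝ) - m| < 1 / 8 := abs_lt.2 ⟨by linarith, by linarith⟩
    linarith
  have mono : ∀ s t : ℝ≥0, (s : ℝ) < t → (τ s : ℝ) < τ t := fun s t hst =>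
    NNReal.coe_lt_coe.2 (τ.strictMono (NNReal.coe_lt_coe.1 hst))
  have lt_symm : ∀ s c : ℝ≥0, (τ s : ℝ) < c → (s : ℝ) < τ.symm c := fun s c hsc =>
    NNReal.coe_lt_coe.2 (τ.lt_symm_apply.2 (NNReal.coe_lt_coe.1 hsc))
  have symm_lt : ∀ s c : ℝ≥0, (c : ℝ) < τ s → (τ.symm c : ℝ) < s := fun s c hsc =>
    NNReal.coe_lt_coe.2 (τ.symm_apply_lt.2 (NNReal.coe_lt_coe.1 hsc))
  obtain ⟨T₀, hT₀⟩ := eventually_atTop.1 h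
  obtain ⟨T, hT⟩ := exists_nat_ge T₀
  have close : ∀ t : ℝ≥0, (T : ℝ) ≤ t → |tents b (τ t) - tents a t| < 1 / 8 := fun t ht =>
    hT₀ t (hT.trans (by exact_mod_cast ht))
  have close' : ∀ c : ℝ≥0, (T : ℝ) ≤ τ.symm c → |tents b c - tents a (τ.symm c)| < 1 / 8 :=
    fun c hc => by simpa using close (τ.symm c) hc
  -- A zero of the first row goes to a point where the second is below `1/8`, hence near one of its
  -- zeros.
  have hρ : ∀ n : ℕ, ∃ m : ℕ, T ≤ n → |(τ n : ℝ) - m| < 1 / 8 := by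
    intro n
    by_cases hn : T ≤ n
    · have h1 := abs_lt.1 (close n (by exact_mod_cast hn))
      rw [tents_natCast] at h1
      obtain ⟨m, hm⟩ := exists_abs_sub_natCast_lt (half_le hb) (t := τ n) (ε := 1 / 8)
        (by linarith)
      exact ⟨m, fun _ => hm⟩
    · exact ⟨0, fun h => (hn h).elim⟩
  choose ρ hρ using hρ
  have step : ∀ n, T ≤ n → ρ (n + 1) = ρ n + 1 := by
    intro n hn
    have hn' : (T : ℝ) ≤ n := by exact_mod_cast hn
    obtain ⟨h1, h2⟩ := abs_lt.1 (hρ n hn)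
    obtain ⟨h3, h4⟩ := abs_lt.1 (hρ (n + 1) (by omega))
    rw [Nat.cast_succ n] at h3 h4
    have h5 := mono n (n + 1 / 2) (by push_cast; linarith)
    have h6 := mono (n + 1 / 2) (n + 1) (by push_cast; linarith)
    refine le_antisymm ?_ ?_
    -- If a zero were skipped, the preimage of `ρ n + 1` would lie between `n` and `n + 1` and
    -- within `1/8` of a zero `k`. Between that preimage and `n` or `n + 1` lies the preimage of a
    -- peak of `b`, also near `k`, where `a`'s tents are too low.
    · by_contra! hlt
      have hlt' : (ρ n : ℝ) + 2 ≤ ρ (n + 1) := by exact_mod_cast hlt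
      have h7 := lt_symm n (ρ n + 1 : ℕ) (by push_cast; linarith)
      have h8 := symm_lt (n + 1) (ρ n + 1 : ℕ) (by push_cast; linarith)
      have h9 := abs_lt.1 (close' (ρ n + 1 : ℕ) (by push_cast at h7 ⊢; linarith))
      rw [tents_natCast] at h9
      obtain ⟨k, hk⟩ := exists_abs_sub_natCast_lt (half_le ha) (t := τ.symm (ρ n + 1 : ℕ))
        (ε := 1 / 8) (by linarith)
      obtain ⟨hk1, hk2⟩ := abs_lt.1 hk
      have bump : ∀ p : ℕ, (n : ℝ) < τ.symm (p + 1 / 2) →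
          (k : ℝ) - 1 / 8 < τ.symm (p + 1 / 2) → (τ.symm (p + 1 / 2) : ℝ) < k + 1 / 8 → False := by
        intro p hp0 hp1 hp2
        have h10 := near ha _ k hp1 hp2
        have h11 := abs_lt.1 (close' (p + 1 / 2) (by linarith))
        rw [tents_add_half] at h11
        linarith [half_le hb p]
      push_cast at h7 h8 hk1 hk2
      rcases le_or_gt k n with hkn | hkn
      · have hkn' : (k : ℝ) ≤ n := by exact_mod_cast hkn
        have h12 := lt_symm n (ρ n + 1 / 2) (by push_cast; linarith)
        have h13 := symm_lt (τ.symm (ρ n + 1)) (ρ n + 1 / 2)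
          (by rw [τ.apply_symm_apply]; push_cast; linarith)
        push_cast at h12
        exact bump (ρ n) h12 (by linarith) (by linarith)
      · have hkn' : (n : ℝ) + 1 ≤ k := by exact_mod_cast hkn
        have h12 := symm_lt (n + 1) ((ρ n + 1 : ℕ) + 1 / 2) (by push_cast; linarith)
        have h13 := lt_symm (τ.symm (ρ n + 1)) ((ρ n + 1 : ℕ) + 1 / 2)
          (by rw [τ.apply_symm_apply]; push_cast; linarith)
        push_cast at h12
        refine bump (ρ n + 1) ?_ ?_ ?_ <;> push_cast at h13 ⊢ <;> linarith
    -- If two zeros merged, the peak at `n + 1/2` would be squeezed near the zero `ρ n`.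
    · by_contra! hlt
      have hlt' : (ρ (n + 1) : ℝ) ≤ ρ n := by exact_mod_cast Nat.lt_succ_iff.1 hlt
      have h7 := near hb (τ (n + 1 / 2)) (ρ n) (by linarith) (by linarith)
      have h8 := abs_lt.1 (close (n + 1 / 2) (by push_cast; linarith))
      rw [tents_add_half] at h8
      linarith [half_le ha n]
  -- A peak of height 1 cannot match a tent of height `1/2`; the collars of width `1/8` around that
  -- tent stay below `1/4`.
  have height : ∀ n, T ≤ n → a n = b (ρ n) := by
    intro n hn
    have hn' : (T : ℝ) ≤ n := by exact_mod_cast hn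
    obtain ⟨h1, h2⟩ := abs_lt.1 (hρ n hn)
    obtain ⟨h3, h4⟩ := abs_lt.1 (hρ (n + 1) (by omega))
    rw [step n hn] at h3 h4
    push_cast at h3 h4
    have h5 := mono n (n + 1 / 2) (by push_cast; linarith)
    have h6 := mono (n + 1 / 2) (n + 1) (by push_cast; linarith)
    rcases ha n with han | han <;> rcases hb (ρ n) with hbn | hbn
    · rw [han, hbn]
    · exfalso
      have h7 := lt_symm n (ρ n + 1 / 2) (by push_cast; linarith)
      have h8 := symm_lt (n + 1) (ρ n + 1 / 2) (by push_cast; linarith)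
      push_cast at h7 h8
      have h9 := abs_lt.1 (close' (ρ n + 1 / 2) (by linarith))
      rw [tents_add_half] at h9
      have h10 := tents_le a (nonneg ha) h7.le h8.le
      linarith
    · exfalso
      have h8 := abs_lt.1 (close (n + 1 / 2) (by push_cast; linarith))
      rw [tents_add_half] at h8
      rcases lt_or_ge (τ (n + 1 / 2) : ℝ) (ρ n) with h9 | h9
      · linarith [near hb _ (ρ n) (by linarith) (by linarith : (τ (n + 1 / 2) : ℝ) < _)]
      rcases lt_or_ge ((ρ n : ℝ) + 1) (τ (n + 1 / 2)) with h10 | h10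
      · linarith [near hb (τ (n + 1 / 2)) (ρ n + 1) (by push_cast; linarith)
          (by push_cast; linarith)]
      linarith [tents_le b (nonneg hb) h9 h10]
    · rw [han, hbn]
  refine ⟨T, ρ T, fun k => ?_⟩
  have : ρ (T + k) = ρ T + k := by
    induction k with
    | zero => rfl
    | succ k ih => rw [← add_assoc, step _ (by omega), ih, add_assoc]
  rw [height _ (by omega), this]

end Tents

/-! ### Tent spirals and their homeomorphisms -/

/-- The inverse of the parametrization `t ↦ 1 / (1 + t)` of `(0,1]`. -/
noncomputable def rayTime (u : ℝ) : ℝ≥0 := (1 / u - 1).toNNReal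

theorem coe_rayTime {u : ℝ} (h0 : 0 < u) (h1 : u ≤ 1) : (rayTime u : ℝ) = 1 / u - 1 := by
  have : 1 ≤ 1 / u := by rwa [le_div_iff₀ h0, one_mul]
  exact Real.coe_toNNReal _ (by linarith)

theorem rayTime_one_div (t : ℝ≥0) : rayTime (1 / (1 + (t : ℝ))) = t := by
  simp [rayTime]

theorem one_div_one_add_rayTime {u : ℝ} (h0 : 0 < u) (h1 : u ≤ 1) :
    1 / (1 + (rayTime u : ℝ)) = u := by
  rw [coe_rayTime h0 h1]
  field_simp
  ring

theorem rayTime_of_nonpos {u : ℝ} (h : u ≤ 0) : rayTime u = 0 := by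
  rw [rayTime, Real.toNNReal_eq_zero]
  have := one_div_nonpos.2 h
  linarith

theorem continuousOn_rayTime : ContinuousOn rayTime (Ioi 0) := by
  refine continuous_real_toNNReal.comp_continuousOn (ContinuousOn.sub ?_ continuousOn_const)
  exact continuousOn_const.div continuousOn_id fun u hu => ne_of_gt hu

theorem one_div_one_add_pos (t : ℝ≥0) : 0 < 1 / (1 + (t : ℝ)) := by positivity

theorem one_div_one_add_le_one (t : ℝ≥0) : 1 / (1 + (t : ℝ)) ≤ 1 := by
  rw [div_le_one (by positivity)]
  linarith [t.coe_nonneg]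

theorem tendsto_one_div_one_add : Tendsto (fun t : ℝ≥0 => 1 / (1 + (t : ℝ))) atTop (𝓝 0) := by
  simp only [one_div]
  exact tendsto_inv_atTop_zero.comp (tendsto_atTop_add_const_left _ _ (NNReal.tendsto_coe_atTop.2 tendsto_id))

/-- The graph of the tents of heights `a n`, where the half-line is reparametrized by `(0,1]`,
together with its limit segment. -/
def tentSpiral (a : ℕ → ℝ) : Set (ℝ × ℝ) :=
  {p | (p.1 ∈ Icc (0 : ℝ) 1 ∧ p.2 ∈ Icc (0 : ℝ) 1) ∧ (0 < p.1 → p.2 = tents a (rayTime p.1))}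

/-- Sequences of tent heights in `{1 / 2, 1}` that are `1` at even places. -/
structure IsHeights (a : ℕ → ℝ) : Prop where
  half_or_one : ∀ n, a n = 1 / 2 ∨ a n = 1
  even : ∀ n, a (2 * n) = 1

section Spiral

variable {a b : ℕ → ℝ}

theorem IsHeights.nonneg (ha : IsHeights a) (n : ℕ) : 0 ≤ a n := by
  rcases ha.half_or_one n with h | h <;> rw [h] <;> norm_num

theorem IsHeights.le_one (ha : IsHeights a) (n : ℕ) : a n ≤ 1 := by
  rcases ha.half_or_one n with h | h <;> rw [h] <;> norm_num

theorem isCompact_tentSpiral (a : ℕ → ℝ) : IsCompact (tentSpiral a) := by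
  have h1 : IsCompact (Icc (0 : ℝ) 1 ×ˢ Icc (0 : ℝ) 1) := isCompact_Icc.prod isCompact_Icc
  have h2 : IsOpen ({p : ℝ × ℝ | 0 < p.1} ∩
      (fun p : ℝ × ℝ => p.2 - tents a (rayTime p.1)) ⁻¹' {0}ᶜ) := by
    refine ContinuousOn.isOpen_inter_preimage ?_ (isOpen_lt continuous_const continuous_fst)
      isClosed_singleton.isOpen_compl
    exact continuousOn_snd.sub ((continuous_tents a).comp_continuousOn
      (continuousOn_rayTime.comp continuousOn_fst fun p hp => hp))
  convert h1.inter_right h2.isClosed_compl using 1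
  ext p
  simp only [tentSpiral, mem_ofPred_eq, mem_inter_iff, mem_prod, mem_compl_iff, mem_preimage,
    mem_singleton_iff, sub_eq_zero, not_and, not_not]

/-- The ray of the spiral. -/
noncomputable def tentRay (ha : IsHeights a) (t : ℝ≥0) : tentSpiral a :=
  ⟨(1 / (1 + (t : ℝ)), tents a t),
    ⟨⟨(one_div_one_add_pos t).le, one_div_one_add_le_one t⟩,
      tents_nonneg ha.nonneg t, tents_le_one ha.nonneg ha.le_one t⟩,
    fun _ => by rw [rayTime_one_div]⟩

theorem continuous_tentRay (ha : IsHeights a) : Continuous (tentRay ha) := by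
  refine Continuous.subtype_mk (Continuous.prodMk ?_ (continuous_tents a)) _
  exact continuous_const.div (by fun_prop) fun t => by positivity

theorem fst_tentRay_pos (ha : IsHeights a) (t : ℝ≥0) : 0 < (tentRay ha t : ℝ × ℝ).1 :=
  one_div_one_add_pos t

theorem rayTime_fst_tentRay (ha : IsHeights a) (t : ℝ≥0) :
    rayTime (tentRay ha t : ℝ × ℝ).1 = t := rayTime_one_div t

theorem tentRay_rayTime (ha : IsHeights a) {p : tentSpiral a} (hp : 0 < p.1.1) :
    tentRay ha (rayTime p.1.1) = p :=
  Subtype.ext (Prod.ext (one_div_one_add_rayTime hp p.2.1.1.2) (p.2.2 hp).symm)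

/-- The limit segment of the spiral. -/
def tentEdge (a : ℕ → ℝ) (v : unitInterval) : tentSpiral a :=
  ⟨(0, v), ⟨⟨le_rfl, zero_le_one⟩, v.2⟩, fun h => (lt_irrefl _ h).elim⟩

theorem continuous_tentEdge (a : ℕ → ℝ) : Continuous (tentEdge a) :=
  Continuous.subtype_mk (by fun_prop) _

theorem tentEdge_snd {p : tentSpiral a} (hp : ¬ 0 < p.1.1) : tentEdge a ⟨p.1.2, p.2.1.2⟩ = p :=
  Subtype.ext (Prod.ext (le_antisymm p.2.1.1.1 (not_lt.1 hp)) rfl)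

/-- The rising side of the tent over `2 * n` has height 1 and slope 2, so it takes the value `v` at
`2 * n + v / 2`. -/
theorem tendsto_tentRay (ha : IsHeights a) (v : unitInterval) :
    Tendsto (fun n : ℕ => tentRay ha (((2 * n : ℕ) : ℝ≥0) + unitInterval.toNNReal v / 2)) atTop
      (𝓝 (tentEdge a v)) := by
  rw [tendsto_subtype_rng]
  have h0 : Tendsto (fun n : ℕ => ((2 * n : ℕ) : ℝ≥0)) atTop atTop :=
    tendsto_natCast_atTop_atTop.comp (tendsto_id.const_mul_atTop' (r := 2) two_pos)
  have h1 : Tendsto (fun n : ℕ => ((2 * n : ℕ) : ℝ≥0) + unitInterval.toNNReal v / 2) atTop atTop :=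
    tendsto_atTop_mono (fun n => le_self_add) h0
  refine (tendsto_one_div_one_add.comp h1).prodMk_nhds ?_
  refine tendsto_const_nhds.congr fun n => ?_
  have hv : ((unitInterval.toNNReal v : ℝ≥0) : ℝ) = v := rfl
  rw [tents_eq_of_mem_Icc a (n := 2 * n), ha.even n]
  · push_cast
    rw [hv, abs_of_nonpos] <;> linarith [v.2.2]
  · push_cast
    rw [hv]
    linarith [v.2.1]
  · push_cast
    rw [hv]
    linarith [v.2.2]

theorem denseRange_tentRay (ha : IsHeights a) : DenseRange (tentRay ha) := by
  intro p
  by_cases hp : 0 < p.1.1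
  · rw [← tentRay_rayTime ha hp]
    exact subset_closure (mem_range_self _)
  · rw [← tentEdge_snd hp]
    exact mem_closure_of_tendsto (tendsto_tentRay ha _) (Eventually.of_forall fun n => mem_range_self _)

/-- Small connected neighbourhoods exist exactly on the ray; this invariant forces homeomorphisms to
preserve the ray. -/
theorem exists_isPreconnected_nhds_of_pos (ha : IsHeights a) {p : tentSpiral a} (hp : 0 < p.1.1)
    {U : Set (tentSpiral a)} (hU : U ∈ 𝓝 p) : ∃ V ∈ 𝓝 p, V ⊆ U ∧ IsPreconnected V := by
  have h1 : tentRay ha ⁻¹' U ∈ 𝓝 (rayTime p.1.1) :=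
    (continuous_tentRay ha).continuousAt.preimage_mem_nhds (by rwa [tentRay_rayTime ha hp])
  obtain ⟨ε, hε, hεU⟩ := Metric.mem_nhds_iff.1 h1
  have hW : IsPreconnected (Metric.ball (rayTime p.1.1) ε) := by
    have : OrdConnected (Metric.ball (rayTime p.1.1) ε) :=
      (Real.ball_eq_Ioo _ ε ▸ ordConnected_Ioo :
        OrdConnected (Metric.ball (rayTime p.1.1 : ℝ) ε)).preimage_mono NNReal.coe_mono
    exact this.isPreconnected
  refine ⟨tentRay ha '' Metric.ball (rayTime p.1.1) ε, ?_, image_subset_iff.2 hεU,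
    hW.image _ (continuous_tentRay ha).continuousOn⟩
  have h2 : ContinuousAt (fun q : tentSpiral a => rayTime q.1.1) p :=
    ContinuousAt.comp (f := fun q : tentSpiral a => q.1.1)
      (continuousOn_rayTime.continuousAt (Ioi_mem_nhds hp)) (by fun_prop)
  have h3 : ∀ᶠ q : tentSpiral a in 𝓝 p, 0 < q.1.1 :=
    (show Continuous fun q : tentSpiral a => q.1.1 by fun_prop).continuousAt.eventually
      (lt_mem_nhds hp)
  filter_upwards [h3, h2.preimage_mem_nhds (Metric.ball_mem_nhds _ hε)] with q hq1 hq2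
  exact ⟨_, hq2, tentRay_rayTime ha hq1⟩

theorem pos_of_exists_isPreconnected_nhds (ha : IsHeights a) {p : tentSpiral a}
    (h : ∀ U ∈ 𝓝 p, ∃ V ∈ 𝓝 p, V ⊆ U ∧ IsPreconnected V) : 0 < p.1.1 := by
  by_contra hp
  have hU : {q : tentSpiral a | |q.1.2 - p.1.2| < 1 / 4} ∈ 𝓝 p :=
    (isOpen_lt (by fun_prop) continuous_const).mem_nhds (by simp)
  obtain ⟨V, hV, hVU, hc⟩ := h _ hU
  have h0 : p.1.1 = 0 := le_antisymm (not_lt.1 hp) p.2.1.1.1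
  obtain ⟨_, hqV, t₀, rfl⟩ := mem_closure_iff_nhds.1 (denseRange_tentRay ha p) V hV
  have hI : Icc 0 (tentRay ha t₀).1.1 ⊆ (fun q : tentSpiral a => q.1.1) '' V :=
    (hc.image _ (by fun_prop)).Icc_subset ⟨p, mem_of_mem_nhds hV, h0⟩ ⟨_, hqV, rfl⟩
  -- The first coordinates of `V` fill an interval starting at 0, so `V` contains a tail of the ray.
  -- There the heights oscillate between 0 and 1, too much for a strip of width `1/2`.
  have key : ∀ t, t₀ ≤ t → |tents a t - p.1.2| < 1 / 4 := by
    intro t ht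
    have h1 : 1 / (1 + (t : ℝ)) ≤ (tentRay ha t₀).1.1 :=
      one_div_le_one_div_of_le (by positivity) (by gcongr)
    obtain ⟨q, hq, hqt⟩ := hI ⟨(one_div_one_add_pos t).le, h1⟩
    have h2 : q = tentRay ha t := by
      have hpos : 0 < q.1.1 := by
        change q.1.1 = _ at hqt
        rw [hqt]
        exact one_div_one_add_pos t
      rw [← tentRay_rayTime ha hpos]
      change q.1.1 = _ at hqt
      rw [hqt, rayTime_one_div]
    have h3 := hVU hq
    rwa [h2] at h3
  obtain ⟨n, hn⟩ := exists_nat_ge t₀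
  have h1 := abs_lt.1 (key (2 * n : ℕ) (by push_cast; linarith [n.cast_nonneg (α := ℝ≥0)]))
  have h2 := abs_lt.1 (key ((2 * n : ℕ) + 1 / 2) (le_trans hn (by
    push_cast
    have : (0 : ℝ≥0) ≤ n := zero_le
    calc (n : ℝ≥0) ≤ 2 * n := by linarith
      _ ≤ _ := le_self_add)))
  rw [tents_natCast] at h1
  rw [tents_add_half, ha.even] at h2
  linarith

theorem fst_pos_of_homeomorph (ha : IsHeights a) (hb : IsHeights b)
    (H : tentSpiral a ≃ₜ tentSpiral b) {p : tentSpiral a} (hp : 0 < p.1.1) : 0 < (H p).1.1 := by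
  refine pos_of_exists_isPreconnected_nhds hb fun U hU => ?_
  obtain ⟨V, hV, hVU, hc⟩ := exists_isPreconnected_nhds_of_pos ha hp
    (H.continuous.continuousAt.preimage_mem_nhds hU)
  exact ⟨H '' V, by rw [← H.map_nhds_eq]; exact image_mem_map hV, image_subset_iff.2 hVU,
    hc.image _ H.continuous.continuousOn⟩

theorem tentRay_rayTime_homeomorph (ha : IsHeights a) (hb : IsHeights b)
    (H : tentSpiral a ≃ₜ tentSpiral b) (t : ℝ≥0) :
    tentRay hb (rayTime (H (tentRay ha t)).1.1) = H (tentRay ha t) :=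
  tentRay_rayTime hb (fst_pos_of_homeomorph ha hb H (fst_tentRay_pos ha t))

theorem continuous_rayTime_homeomorph (ha : IsHeights a) (hb : IsHeights b)
    (H : tentSpiral a ≃ₜ tentSpiral b) : Continuous fun t => rayTime (H (tentRay ha t)).1.1 := by
  have hc : Continuous fun t => (H (tentRay ha t)).1.1 :=
    continuous_fst.comp (continuous_subtype_val.comp (H.continuous.comp (continuous_tentRay ha)))
  exact continuousOn_rayTime.comp_continuous hc
    fun t => fst_pos_of_homeomorph ha hb H (fst_tentRay_pos ha t)

/-- A homeomorphism between spirals reparametrizes the ray. -/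
noncomputable def rayHomeomorph (ha : IsHeights a) (hb : IsHeights b)
    (H : tentSpiral a ≃ₜ tentSpiral b) : ℝ≥0 ≃ₜ ℝ≥0 where
  toFun t := rayTime (H (tentRay ha t)).1.1
  invFun t := rayTime (H.symm (tentRay hb t)).1.1
  left_inv t := by
    dsimp only
    rw [tentRay_rayTime_homeomorph, H.symm_apply_apply, rayTime_fst_tentRay]
  right_inv t := by
    dsimp only
    rw [tentRay_rayTime_homeomorph, H.apply_symm_apply, rayTime_fst_tentRay]
  continuous_toFun := continuous_rayTime_homeomorph ha hb H
  continuous_invFun := continuous_rayTime_homeomorph hb ha H.symm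

/-- A decreasing bijection would make the image of 0 a greatest element. -/
theorem Homeomorph.strictMono_nnreal (e : ℝ≥0 ≃ₜ ℝ≥0) : StrictMono e := by
  rcases e.continuous.strictMono_of_inj e.injective with h | h
  · exact h
  · have h1 := h.antitone (zero_le : 0 ≤ e.symm (e 0 + 1))
    rw [e.apply_symm_apply] at h1
    exact absurd h1 (not_le.2 (lt_add_one _))

/-- The function `h` reads off the action of `H` on the limit segment. A far point of the ray is
close to its horizontal projection to the segment, so by compactness the images have close heights.
-/
theorem exists_asymptotic_conjugacy (ha : IsHeights a) (hb : IsHeights b)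
    (H : tentSpiral a ≃ₜ tentSpiral b) :
    ∃ (τ : ℝ≥0 ≃o ℝ≥0) (h : C(unitInterval, ℝ)), ∀ ε > 0, ∀ᶠ t in atTop,
      |tents b (τ t) - h (projIcc 0 1 zero_le_one (tents a t))| < ε := by
  let e := rayHomeomorph ha hb H
  let h : C(unitInterval, ℝ) := ⟨fun v => (H (tentEdge a v)).1.2, continuous_snd.comp
    (continuous_subtype_val.comp (H.continuous.comp (continuous_tentEdge a)))⟩
  refine ⟨e.strictMono_nnreal.orderIsoOfSurjective e e.surjective, h, fun ε hε => ?_⟩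
  have hcs : CompactSpace (tentSpiral a) := isCompact_iff_compactSpace.1 (isCompact_tentSpiral a)
  let D : tentSpiral a → ℝ := fun p => |(H p).1.2 - h (projIcc 0 1 zero_le_one p.1.2)|
  have hD : Continuous D := by
    refine (Continuous.sub ?_ ?_).abs
    · exact continuous_snd.comp (continuous_subtype_val.comp H.continuous)
    · exact h.continuous.comp (continuous_projIcc.comp (by fun_prop))
  have hK : IsCompact {p | ε ≤ D p} := (isClosed_le continuous_const hD).isCompact
  have hDr : ∀ t, |tents b (e t) - h (projIcc 0 1 zero_le_one (tents a t))| = D (tentRay ha t) := by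
    intro t
    have h1 : (tentRay hb (e t)).1.2 = (H (tentRay ha t)).1.2 := by
      rw [← tentRay_rayTime_homeomorph ha hb H t]
      rfl
    change |(tentRay hb (e t)).1.2 - _| = _
    rw [h1]
    rfl
  change ∀ᶠ t in atTop, |tents b (e t) - h (projIcc 0 1 zero_le_one (tents a t))| < ε
  simp only [hDr]
  rcases eq_empty_or_nonempty {p | ε ≤ D p} with hE | hE
  · exact Eventually.of_forall fun t => not_le.1 fun h => (hE.subset h).elim
  · obtain ⟨m, hm, hmin⟩ := hK.exists_isMinOn hE
      (show Continuous fun p : tentSpiral a => p.1.1 by fun_prop).continuousOn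
    have hpos : 0 < m.1.1 := by
      by_contra hcon
      have h0 : D m = 0 := by
        have h1 := tentEdge_snd hcon
        change |(H m).1.2 - (H (tentEdge a (projIcc 0 1 zero_le_one m.1.2))).1.2| = 0
        rw [projIcc_of_mem zero_le_one m.2.1.2, h1, sub_self, abs_zero]
      have h2 : ε ≤ D m := hm
      linarith
    filter_upwards [tendsto_one_div_one_add.eventually (gt_mem_nhds hpos)] with t ht
    by_contra hcon
    exact (hmin (not_lt.1 hcon)).not_gt ht

end Spiral

/-! ### Finite changes of heights, and realization in the Hilbert cube -/

/-- The difference vanishes near 0: to the right because late tents agree, to the left because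
`rayTime` defaults to 0, a zero of every row. -/
theorem continuous_sub_tents_rayTime {a b : ℕ → ℝ} (h : a =ᶠ[atTop] b) :
    Continuous fun u => tents b (rayTime u) - tents a (rayTime u) := by
  rw [continuous_iff_continuousAt]
  intro u
  rcases lt_or_ge 0 u with hu | hu
  · have hr : ContinuousAt rayTime u := continuousOn_rayTime.continuousAt (Ioi_mem_nhds hu)
    exact ((continuous_tents b).continuousAt.comp hr).sub ((continuous_tents a).continuousAt.comp hr)
  · obtain ⟨N, hN⟩ := eventually_atTop.1 h
    have hlt : u < 1 / (1 + (N : ℝ)) := hu.trans_lt (by positivity)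
    refine continuousAt_const.congr (f := fun _ => (0 : ℝ)) ?_
    filter_upwards [gt_mem_nhds hlt] with w hw
    rcases lt_or_ge 0 w with hw0 | hw0
    · have h1 : (N : ℝ) ≤ rayTime w := by
        have hw1 : w ≤ 1 := hw.le.trans (by
          rw [div_le_one (by positivity)]
          linarith [N.cast_nonneg (α := ℝ)])
        rw [coe_rayTime hw0 hw1]
        have := (lt_one_div hw0 (by positivity)).1 hw
        linarith
      have h2 : N ≤ ⌊rayTime w⌋₊ := Nat.le_floor (by exact_mod_cast h1)
      rw [tents, tents, hN _ h2, sub_self]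
    · rw [rayTime_of_nonpos hw0, tents_zero, tents_zero, sub_self]

/-- Spirals whose sequences of heights agree eventually are homeomorphic. -/
theorem nonempty_homeomorph_of_eventuallyEq {a b : ℕ → ℝ} (ha : IsHeights a) (hb : IsHeights b)
    (h : a =ᶠ[atTop] b) : Nonempty (tentSpiral a ≃ₜ tentSpiral b) := by
  have hc := continuous_sub_tents_rayTime h
  -- A vertical shear of the plane carries one graph to the other and fixes the limit segment.
  let e : ℝ × ℝ ≃ₜ ℝ × ℝ :=
    { toFun p := (p.1, p.2 + (tents b (rayTime p.1) - tents a (rayTime p.1)))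
      invFun p := (p.1, p.2 - (tents b (rayTime p.1) - tents a (rayTime p.1)))
      left_inv p := by simp
      right_inv p := by simp
      continuous_toFun := continuous_fst.prodMk (continuous_snd.add (hc.comp continuous_fst))
      continuous_invFun := continuous_fst.prodMk (continuous_snd.sub (hc.comp continuous_fst)) }
  refine ⟨e.subtype fun p => ?_⟩
  change (_ ∧ (_ → _)) ↔ ((p.1 ∈ Icc (0 : ℝ) 1 ∧
    p.2 + (tents b (rayTime p.1) - tents a (rayTime p.1)) ∈ Icc (0 : ℝ) 1) ∧ (0 < p.1 →
      p.2 + (tents b (rayTime p.1) - tents a (rayTime p.1)) = tents b (rayTime p.1)))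
  rcases lt_or_ge 0 p.1 with hp | hp
  · constructor
    · rintro ⟨⟨h1, h2⟩, h3⟩
      rw [h3 hp, add_sub_cancel]
      exact ⟨⟨h1, tents_nonneg hb.nonneg _, tents_le_one hb.nonneg hb.le_one _⟩, fun _ => rfl⟩
    · rintro ⟨⟨h1, h2⟩, h3⟩
      have h4 : p.2 = tents a (rayTime p.1) := by linarith [h3 hp]
      exact ⟨⟨h1, h4 ▸ ⟨tents_nonneg ha.nonneg _, tents_le_one ha.nonneg ha.le_one _⟩⟩, fun _ => h4⟩
  · simp [rayTime_of_nonpos hp, tents_zero, hp.not_gt]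

theorem IsSpiralOver.of_homeomorph {K S S' : Type*} [TopologicalSpace K] [TopologicalSpace S]
    [TopologicalSpace S'] (h : IsSpiralOver K S) (e : S ≃ₜ S') : IsSpiralOver K S' where
  compactSpace := have := h.compactSpace; e.compactSpace
  metrizableSpace := have := h.metrizableSpace; e.symm.isEmbedding.metrizableSpace
  exists_ray := by
    obtain ⟨j, hj, ⟨f⟩⟩ := h.exists_ray
    refine ⟨e ∘ j, ⟨⟨e.isInducing.comp hj.toIsInducing,
      e.surjective.denseRange.comp hj.dense e.continuous⟩, e.injective.comp hj.injective⟩, ⟨?_⟩⟩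
    refine Homeomorph.trans (e.symm.subtype fun x => ?_) f
    simp only [mem_compl_iff, mem_range, Function.comp_apply, ← e.eq_symm_apply]

theorem isSpiralOver_tentSpiral {a : ℕ → ℝ} (ha : IsHeights a) :
    IsSpiralOver unitInterval (tentSpiral a) where
  compactSpace := isCompact_iff_compactSpace.1 (isCompact_tentSpiral a)
  metrizableSpace := inferInstance
  exists_ray := by
    let j : Ioc (0 : ℝ) 1 → tentSpiral a := fun u => tentRay ha (rayTime u)
    have hfst : ∀ u, (j u).1.1 = u := fun u => one_div_one_add_rayTime u.2.1 u.2.2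
    have hrange : ∀ p, p ∈ range j ↔ 0 < p.1.1 := by
      intro p
      constructor
      · rintro ⟨u, rfl⟩
        exact fst_tentRay_pos ha _
      · exact fun hp => ⟨⟨p.1.1, hp, p.2.1.1.2⟩, tentRay_rayTime ha hp⟩
    have hj : Continuous j := (continuous_tentRay ha).comp
      (continuousOn_rayTime.comp_continuous continuous_subtype_val fun u => u.2.1)
    have hemb : IsEmbedding j := by
      refine IsEmbedding.of_comp hj
        (show Continuous fun p : tentSpiral a => p.1.1 by fun_prop) ?_
      rw [show (fun p : tentSpiral a => p.1.1) ∘ j = Subtype.val from funext hfst]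
      exact IsEmbedding.subtypeVal
    refine ⟨j, ⟨⟨hemb.isInducing, (denseRange_tentRay ha).mono ?_⟩, hemb.injective⟩, ⟨?_⟩⟩
    · rintro _ ⟨t, rfl⟩
      exact (hrange _).2 (fst_tentRay_pos ha t)
    · exact
        { toFun p := ⟨p.1.1.2, p.1.2.1.2⟩
          invFun v := ⟨tentEdge a v, fun h => lt_irrefl _ ((hrange _).1 h)⟩
          left_inv p := Subtype.ext (tentEdge_snd fun h => p.2 ((hrange _).2 h))
          right_inv v := rfl
          continuous_toFun := by fun_prop
          continuous_invFun := (continuous_tentEdge a).subtype_mk _ }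

/-- The unit square as a face of the Hilbert cube. -/
noncomputable def squareToHilbertCube (p : ℝ × ℝ) : HilbertCube := fun n =>
  projIcc 0 1 zero_le_one (if n = 0 then p.1 else p.2)

theorem continuous_squareToHilbertCube : Continuous squareToHilbertCube :=
  continuous_pi fun n => continuous_projIcc.comp (by split_ifs <;> fun_prop)

theorem injOn_squareToHilbertCube (a : ℕ → ℝ) : InjOn squareToHilbertCube (tentSpiral a) := by
  intro p hp q hq h
  have h0 := congrArg Subtype.val (congrFun h 0)
  have h1 := congrArg Subtype.val (congrFun h 1)
  simp only [squareToHilbertCube, if_true, one_ne_zero, if_false, projIcc_of_mem _ hp.1.1,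
    projIcc_of_mem _ hp.1.2, projIcc_of_mem _ hq.1.1, projIcc_of_mem _ hq.1.2] at h0 h1
  exact Prod.ext h0 h1

/-- The spiral with tents of heights `a n`, as a compact subset of the Hilbert cube. -/
noncomputable def cubeSpiral (a : ℕ → ℝ) : Compacts HilbertCube :=
  ⟨squareToHilbertCube '' tentSpiral a,
    (isCompact_tentSpiral a).image continuous_squareToHilbertCube⟩

theorem nonempty_homeomorph_cubeSpiral (a : ℕ → ℝ) :
    Nonempty (tentSpiral a ≃ₜ (cubeSpiral a : Set HilbertCube)) := by
  have : CompactSpace (tentSpiral a) := isCompact_iff_compactSpace.1 (isCompact_tentSpiral a)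
  refine ⟨Continuous.homeoOfEquivCompactToT2
    (f := (injOn_squareToHilbertCube a).bijOn_image.equiv _) ?_⟩
  exact (continuous_squareToHilbertCube.comp continuous_subtype_val).subtype_mk _

theorem cubeSpiral_mem_spirals {a : ℕ → ℝ} (ha : IsHeights a) :
    cubeSpiral a ∈ spirals unitInterval :=
  (isSpiralOver_tentSpiral ha).of_homeomorph (nonempty_homeomorph_cubeSpiral a).some

/-! ### Coding the Cantor space, and the contradiction -/

/-- The tent heights that encode a point of the Cantor space at the odd places. -/
noncomputable def heights (x : ℕ → Bool) (n : ℕ) : ℝ := if Even n ∨ x (n / 2) then 1 else 1 / 2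

theorem isHeights_heights (x : ℕ → Bool) : IsHeights (heights x) where
  half_or_one n := by
    unfold heights
    split_ifs <;> simp
  even n := by simp [heights]

theorem heights_odd (x : ℕ → Bool) (n : ℕ) :
    heights x (2 * n + 1) = if x n then 1 else 1 / 2 := by
  have : (2 * n + 1) / 2 = n := by omega
  simp [heights, this]

theorem heights_eventuallyEq {x y : ℕ → Bool} (h : x =ᶠ[atTop] y) :
    heights x =ᶠ[atTop] heights y := by
  obtain ⟨N, hN⟩ := eventually_atTop.1 h
  filter_upwards [eventually_ge_atTop (2 * N)] with n hn
  rw [heights, heights, hN (n / 2) (by omega)]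

theorem continuous_heights (n : ℕ) : Continuous fun x => heights x n :=
  (continuous_of_discreteTopology (f := fun b : Bool => if Even n ∨ b then (1 : ℝ) else 1 / 2)).comp
    (continuous_apply (n / 2))

/-- For given shifts, the odd places determine `x` up to finitely many bits. -/
theorem countable_setOf_heights_shift (a : ℕ → ℝ) :
    {x | ∃ N M, ∀ k, heights x (N + k) = a (M + k)}.Countable := by
  classical
  have hsub : {x | ∃ N M, ∀ k, heights x (N + k) = a (M + k)} ⊆
      ⋃ N : ℕ, ⋃ M : ℕ, {x | x =ᶠ[atTop] fun n => decide (a (M + (2 * n + 1 - N)) = 1)} := by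
    rintro x ⟨N, M, hx⟩
    refine mem_iUnion₂.2 ⟨N, M, ?_⟩
    filter_upwards [eventually_ge_atTop N] with n hn
    have h1 := hx (2 * n + 1 - N)
    rw [show N + (2 * n + 1 - N) = 2 * n + 1 by omega, heights_odd] at h1
    rw [← h1]
    cases x n <;> norm_num
  exact (countable_iUnion fun N => countable_iUnion fun M => countable_setOf_eventuallyEq _).mono hsub

/-- Uncountably many of the spirals over the interval cannot be homeomorphic to each other. -/
theorem countable_of_homeomorph {A : Set (ℕ → Bool)} {x₀ : ℕ → Bool}
    (hA : ∀ x ∈ A, Nonempty (tentSpiral (heights x₀) ≃ₜ tentSpiral (heights x))) :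
    A.Countable := by
  by_contra hcon
  have hex : ∀ x, ∃ (τ : ℝ≥0 ≃o ℝ≥0) (h : C(unitInterval, ℝ)), x ∈ A → ∀ ε > 0, ∀ᶠ t in atTop,
      |tents (heights x) (τ t) - h (projIcc 0 1 zero_le_one (tents (heights x₀) t))| < ε := by
    intro x
    by_cases hx : x ∈ A
    · obtain ⟨τ, h, hτ⟩ := exists_asymptotic_conjugacy (isHeights_heights x₀) (isHeights_heights x)
        (hA x hx).some
      exact ⟨τ, h, fun _ => hτ⟩
    · exact ⟨OrderIso.refl _, 0, fun h => (hx h).elim⟩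
  choose τ h hτ using hex
  -- Three errors of `1/24`, two from the conjugacies and one from the distance of the functions
  -- `h`, add up to `1/8`.
  obtain ⟨B, hBA, hB, hBd⟩ := exists_not_countable_dist_lt hcon h (ε := 1 / 24) (by norm_num)
  obtain ⟨y, hy⟩ : B.Nonempty := by
    rw [nonempty_iff_ne_empty]
    rintro rfl
    exact hB countable_empty
  refine hB ((countable_setOf_heights_shift (heights y)).mono fun x hx => ?_)
  refine exists_shift_eq_of_tents_close (isHeights_heights x).half_or_one
    (isHeights_heights y).half_or_one ((τ x).symm.trans (τ y)) ?_
  have hev : ∀ᶠ t in atTop,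
      |tents (heights y) (τ y t) - tents (heights x) (τ x t)| < 1 / 8 := by
    filter_upwards [hτ x (hBA hx) (1 / 24) (by norm_num), hτ y (hBA hy) (1 / 24) (by norm_num)]
      with t h1 h2
    have h3 := (ContinuousMap.dist_apply_le_dist (f := h x) (g := h y)
      (projIcc 0 1 zero_le_one (tents (heights x₀) t))).trans_lt (hBd x hx y hy)
    rw [Real.dist_eq] at h3
    rw [abs_lt] at *
    constructor <;> linarith
  filter_upwards [(τ x).symm.tendsto_atTop.eventually hev] with t ht
  simpa using ht

theorem polishSpace_bool : PolishSpace Bool :=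
  (IsClosedEmbedding.of_continuous_injective_isClosedMap (continuous_of_discreteTopology)
    (by decide : Function.Injective Bool.toNat) fun _ _ => isClosed_discrete _).polishSpace

theorem corollary2p6 :
    ¬ UniquelyPolishable.{u, v, 0} (spirals unitInterval) := by
  rintro ⟨X, Y, _, _, _, _, π, hπ, huniq⟩
  borelize Y
  have := polishSpace_bool
  have hfib : ∀ x : ℕ → Bool,
      ∃ y₀ : Y, ∀ y, Nonempty ((π ⁻¹' {y} : Set X) ≃ₜ tentSpiral (heights x)) ↔ y = y₀ := by
    intro x
    obtain ⟨e⟩ := nonempty_homeomorph_cubeSpiral (heights x)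
    obtain ⟨y₀, ⟨g⟩, hy₀⟩ := huniq _ (cubeSpiral_mem_spirals (isHeights_heights x))
    refine ⟨y₀, fun y => ⟨fun ⟨g'⟩ => hy₀ y ⟨g'.trans e⟩, ?_⟩⟩
    rintro rfl
    exact ⟨g.trans e.symm⟩
  choose f hf using hfib
  have hmeas : Measurable f :=
    -- A fixed dense sequence of times on the ray gives points that vary continuously with `x`,
    -- since each depends on a single height.
    measurable_of_unique_fiber hπ (fun x => isCompact_tentSpiral (heights x))
      (s := fun x n => tentRay (isHeights_heights x) (denseSeq ℝ≥0 n))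
      (fun x => (denseRange_tentRay (isHeights_heights x)).comp (denseRange_denseSeq _)
        (continuous_tentRay _))
      (fun n => continuous_const.prodMk ((continuous_heights _).mul continuous_const)) hf
  obtain ⟨A, hA, hAeq⟩ := exists_mem_residual_eq_of_flip_invariant hmeas fun F x => by
    obtain ⟨g⟩ := (hf (flipHomeomorph F x) _).2 rfl
    obtain ⟨e⟩ := nonempty_homeomorph_of_eventuallyEq (isHeights_heights _) (isHeights_heights _)
      (heights_eventuallyEq (flipHomeomorph_eventuallyEq F x))
    exact (hf x _).1 ⟨g.trans e⟩
  obtain ⟨x₀, hx₀⟩ := (dense_of_mem_residual hA).nonempty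
  refine not_countable_of_mem_residual hA (countable_of_homeomorph (x₀ := x₀) fun x hx => ?_)
  obtain ⟨g⟩ := (hf x₀ _).2 rfl
  obtain ⟨g'⟩ := (hf x _).2 (hAeq x₀ hx₀ x hx)
  exact ⟨g.symm.trans g'⟩
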